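/- Let $R$ be a $*$-regular ring, that is, an associative unital ring with an involution $r\mapsto r^*$ such that for every $a\in R$ there is $x\in R$ with $axa=a$, and such that $rr^*=0$ implies $r=0$. Suppose that $R$ is subdirectly irreducible, i.e. among the nonzero two-sided ideals of $R$ there is a smallest one, denoted $M(R)$, and that the socle $\mathrm{Soc}(R)$, the sum of all minimal right ideals of $R$, is nonzero. Then: 1. $\mathrm{Soc}(R)=M(R)$; 2. for every projection $e=e^2=e^*\in M(R)$ the corner ring $eRe$ (with unit $e$) is artinian (left and right); 3. $R$ is representable: there are a division ring $F$ with involution, a right $F$-vector space $V$, and a sesquilinear form $\langle\cdot\,|\,\cdot\rangle : V\times V\to F$ (biadditive with $\langle v\alpha\,|\,w\beta\rangle=\alpha^*\langle v\,|\,w\rangle\beta$) that is anisotropic ($\langle v\,|\,v\rangle=0$ only for $v=0$) and orthosymmetric ($\langle v\,|\,w\rangle=0$ if and only if $\langle w\,|\,v\rangle=0$), together with an injective unital homomorphism of $*$-rings $R\to\mathrm{End}^*(V)$, where $\mathrm{End}^*(V)$ is the $*$-ring of those $F$-linear endomorphisms of $V$ that have an adjoint with respect to $\langle\cdot\,|\,\cdot\rangle$,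 with the adjoint as involution. -/

import Mathlib

open MulOpposite

/-- A star ring is star-regular if it is von Neumann regular and its involution is proper. -/
structure IsStarRegular (R : Type*) [Ring R] [StarRing R] : Prop where
  regular : ∀ a : R, ∃ x : R, a * x * a = a
  proper : ∀ r : R, r * star r = 0 → r = 0

/-- `R` is subdirectly irreducible: among the nonzero two-sided ideals there is a smallest one. -/
def IsSubdirectlyIrreducible (R : Type*) [Ring R] : Prop :=
  ∃ M : TwoSidedIdeal R, IsLeast {I : TwoSidedIdeal R | I ≠ ⊥} M

/-- The intersection of all nonzero two-sided ideals; for a subdirectly irreducible ring this is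
its unique minimal ideal `M(R)`. -/
noncomputable def minimalIdeal (R : Type*) [Ring R] : TwoSidedIdeal R :=
  sInf {I : TwoSidedIdeal R | I ≠ ⊥}

/-- For a subdirectly irreducible ring, `minimalIdeal R` is the smallest nonzero ideal. -/
theorem IsSubdirectlyIrreducible.isLeast_minimalIdeal {R : Type*} [Ring R]
    (h : IsSubdirectlyIrreducible R) :
    IsLeast {I : TwoSidedIdeal R | I ≠ ⊥} (minimalIdeal R) := by
  obtain ⟨M, hM⟩ := h
  have e : minimalIdeal R = M := hM.isGLB.sInf_eq
  rwa [e]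

/-- The socle: the sum of all minimal right ideals (right ideals being the submodules of `R` over
the opposite ring). -/
noncomputable def rightSocle (R : Type*) [Ring R] : Submodule Rᵐᵒᵖ R :=
  sSup {I : Submodule Rᵐᵒᵖ R | IsAtom I}

/-- An inner product on a right vector space `V` over a division ring with involution `F`:
an anisotropic orthosymmetric sesquilinear form. The right action `v a` is `op a • v`. -/
structure InnerProduct (F V : Type*) [DivisionRing F] [StarRing F] [AddCommGroup V]
    [Module Fᵐᵒᵖ V] where
  form : V → V → F
  add_left : ∀ u v w, form (u + v) w = form u w + form v w
  add_right : ∀ u v w, form u (v + w) = form u v + form u w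
  smul_smul : ∀ (a b : F) (v w : V), form (op a • v) (op b • w) = star a * form v w * b
  anisotropic : ∀ v, form v v = 0 → v = 0
  orthosymmetric : ∀ v w, form v w = 0 ↔ form w v = 0

namespace InnerProduct

variable {F V : Type*} [DivisionRing F] [StarRing F] [AddCommGroup V] [Module Fᵐᵒᵖ V]
  (B : InnerProduct F V)

/-- `φ` and `ψ` are adjoint to each other. (Both identities are demanded, so that this relation is
symmetric for every inner product, also on one-dimensional spaces.) -/
def IsAdjoint (φ ψ : Module.End Fᵐᵒᵖ V) : Prop :=
  (∀ v w, B.form (φ v) w = B.form v (ψ w)) ∧ (∀ v w, B.form (ψ v) w = B.form v (φ w))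

theorem form_zero_left (w : V) : B.form 0 w = 0 := by
  have h := B.add_left 0 0 w
  simpa using h

theorem form_zero_right (v : V) : B.form v 0 = 0 := by
  have h := B.add_right v 0 0
  simpa using h

theorem form_neg_left (v w : V) : B.form (-v) w = -B.form v w := by
  have h := B.add_left v (-v) w
  rw [add_neg_cancel, form_zero_left] at h
  exact (neg_eq_of_add_eq_zero_right h.symm).symm

theorem form_neg_right (v w : V) : B.form v (-w) = -B.form v w := by
  have h := B.add_right v w (-w)
  rw [add_neg_cancel, form_zero_right] at h
  exact (neg_eq_of_add_eq_zero_right h.symm).symm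

theorem eq_of_forall_form {u v : V} (h : ∀ w, B.form w u = B.form w v) : u = v := by
  have h1 : B.form (u - v) (u - v) = 0 := by
    rw [sub_eq_add_neg u v, B.add_right, form_neg_right, h, add_neg_cancel]
  exact sub_eq_zero.mp (B.anisotropic _ h1)

variable {B}

theorem IsAdjoint.symm {φ ψ : Module.End Fᵐᵒᵖ V} (h : B.IsAdjoint φ ψ) : B.IsAdjoint ψ φ :=
  ⟨h.2, h.1⟩

theorem IsAdjoint.unique {φ ψ χ : Module.End Fᵐᵒᵖ V} (h : B.IsAdjoint φ ψ)
    (h' : B.IsAdjoint φ χ) : ψ = χ := by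
  ext w
  exact B.eq_of_forall_form fun v => (h.1 v w).symm.trans (h'.1 v w)

theorem IsAdjoint.add {φ ψ φ' ψ' : Module.End Fᵐᵒᵖ V} (h : B.IsAdjoint φ ψ)
    (h' : B.IsAdjoint φ' ψ') : B.IsAdjoint (φ + φ') (ψ + ψ') :=
  ⟨fun v w => by simp [B.add_left, B.add_right, h.1, h'.1],
   fun v w => by simp [B.add_left, B.add_right, h.2, h'.2]⟩

theorem IsAdjoint.neg {φ ψ : Module.End Fᵐᵒᵖ V} (h : B.IsAdjoint φ ψ) :
    B.IsAdjoint (-φ) (-ψ) :=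
  ⟨fun v w => by simp [form_neg_left, form_neg_right, h.1],
   fun v w => by simp [form_neg_left, form_neg_right, h.2]⟩

theorem IsAdjoint.mul {φ ψ φ' ψ' : Module.End Fᵐᵒᵖ V} (h : B.IsAdjoint φ ψ)
    (h' : B.IsAdjoint φ' ψ') : B.IsAdjoint (φ * φ') (ψ' * ψ) :=
  ⟨fun v w => by simp [Module.End.mul_apply, h.1, h'.1],
   fun v w => by simp [Module.End.mul_apply, h.2, h'.2]⟩

variable (B)

theorem isAdjoint_zero : B.IsAdjoint 0 0 :=
  ⟨fun v w => by simp [form_zero_left, form_zero_right],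
   fun v w => by simp [form_zero_left, form_zero_right]⟩

theorem isAdjoint_one : B.IsAdjoint 1 1 :=
  ⟨fun _ _ => rfl, fun _ _ => rfl⟩

/-- `End*(V)`: the ring of those endomorphisms of the right vector space `V` that have an
adjoint. -/
def EndStar : Subring (Module.End Fᵐᵒᵖ V) where
  carrier := {φ | ∃ ψ, B.IsAdjoint φ ψ}
  mul_mem' := by rintro _ _ ⟨_, h⟩ ⟨_, h'⟩; exact ⟨_, h.mul h'⟩
  one_mem' := ⟨_, B.isAdjoint_one⟩
  add_mem' := by rintro _ _ ⟨_, h⟩ ⟨_, h'⟩; exact ⟨_, h.add h'⟩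
  zero_mem' := ⟨_, B.isAdjoint_zero⟩
  neg_mem' := by rintro _ ⟨_, h⟩; exact ⟨_, h.neg⟩

/-- The involution of `End*(V)` sends an endomorphism to its adjoint. -/
noncomputable instance : Star B.EndStar where
  star φ := ⟨Classical.choose φ.2, φ.1, (Classical.choose_spec φ.2).symm⟩

theorem isAdjoint_star (φ : B.EndStar) :
    B.IsAdjoint (φ : Module.End Fᵐᵒᵖ V) (star φ : B.EndStar) :=
  Classical.choose_spec φ.2

noncomputable instance : StarRing B.EndStar where
  star_involutive φ :=
    Subtype.ext ((B.isAdjoint_star (star φ)).unique (B.isAdjoint_star φ).symm)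
  star_mul φ ψ :=
    Subtype.ext ((B.isAdjoint_star (φ * ψ)).unique
      ((B.isAdjoint_star φ).mul (B.isAdjoint_star ψ)))
  star_add φ ψ :=
    Subtype.ext ((B.isAdjoint_star (φ + ψ)).unique
      ((B.isAdjoint_star φ).add (B.isAdjoint_star ψ)))

end InnerProduct

/-- `R` is representable: it embeds, as a unital star ring, into `End*(V)` for an inner product
space `V` over some division star ring `F`. -/
def IsRepresentable.{u} (R : Type u) [Ring R] [StarRing R] : Prop :=
  ∃ (F V : Type u) (_ : DivisionRing F) (_ : StarRing F) (_ : AddCommGroup V)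
    (_ : Module Fᵐᵒᵖ V) (B : InnerProduct F V) (ι : R →+* B.EndStar),
    Function.Injective ι ∧ ∀ r : R, ι (star r) = star (ι r)

/-! Properness and regularity put a projection `e` in every nonzero right ideal. The socle is a
nonzero two-sided ideal, so it contains M(R). A minimal right ideal outside M(R) would annihilate
M(R) from the left, forcing M(R)² = 0, which regularity excludes (`rightSocle_eq_minimalIdeal`).
Each socle element lies in a finite sum of minimal right ideals, which is artinian. Right ideals of
eRe embed in its submodule lattice (`isArtinianRing_op`), and the involution handles the left side.
For a projection e ≠ 0 in a minimal right ideal, eRe is a division ring by Schur's argument. R acts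
on V = Re with form v*w, and faithfully, since a nonzero kernel would contain M(R) and hence e. -/

open MulOpposite

/-! ### Projections in star-regular rings -/

namespace IsStarRegular

variable {R : Type*} [Ring R] [StarRing R]

/-- In a star-regular ring every principal right ideal is generated by a projection. -/
theorem exists_isStarProjection (h : IsStarRegular R) (a : R) :
    ∃ p : R, IsStarProjection p ∧ p * a = a ∧ ∃ y, p = a * y := by
  obtain ⟨x, hx⟩ := h.regular (star a * a)
  -- The difference d lies in aR and a*d = 0, so d*d = 0 and properness gives d = 0.
  have hd : a * x * (star a * a) - a = 0 := by
    rw [← star_eq_zero]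
    apply h.proper
    have h0 : star a * (a * x * (star a * a) - a) = 0 := by
      rw [mul_sub, sub_eq_zero, ← mul_assoc, ← mul_assoc (star a), hx]
    rw [star_star]
    have h1 : a * x * (star a * a) - a = a * (x * (star a * a) - 1) := by
      rw [mul_sub, mul_one, mul_assoc a]
    nth_rewrite 1 [h1]
    rw [star_mul, mul_assoc, h0, mul_zero]
  have ha : a * x * star a * a = a := by
    rw [mul_assoc _ (star a) a]
    exact sub_eq_zero.mp hd
  have hstar : star (a * x * star a) = a * star x * star a := by
    simp [mul_assoc]
  have hpp : a * x * star a * star (a * x * star a) = star (a * x * star a) := by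
    rw [hstar, ← mul_assoc, ← mul_assoc, ha]
  -- For p = axa*, the identity pp* = p* makes p* self-adjoint, hence p = p* and p² = p.
  have hsa : star (a * x * star a) = a * x * star a := by
    have h2 := congrArg star hpp
    rw [star_mul, star_star] at h2
    exact hpp.symm.trans h2
  refine ⟨a * x * star a, ⟨?_, hsa⟩, ha, x * star a, mul_assoc _ _ _⟩
  rw [hsa] at hpp
  exact hpp

end IsStarRegular

/-! ### The socle and the minimal ideal -/

section Socle

variable {R : Type*} [Ring R]

theorem exists_mul_eq_of_isAtom {I : Submodule Rᵐᵒᵖ R} (hI : IsAtom I) {x y : R} (hx : x ∈ I)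
    (hx0 : x ≠ 0) (hy : y ∈ I) : ∃ r, x * r = y := by
  have hle : Submodule.span Rᵐᵒᵖ {x} ≤ I := by simpa using hx
  have heq := (hI.le_iff.mp hle).resolve_left (by simpa using hx0)
  rw [← heq] at hy
  obtain ⟨r, hr⟩ := Submodule.mem_span_singleton.mp hy
  exact ⟨r.unop, hr⟩

/-- Left multiplication is right linear, so by Schur's lemma rI is zero or isomorphic to the minimal
right ideal I, hence again minimal. -/
theorem mul_mem_rightSocle (r : R) {x : R} (hx : x ∈ rightSocle R) : r * x ∈ rightSocle R := by
  suffices h : rightSocle R ≤ (rightSocle R).comap (LinearMap.mulLeft Rᵐᵒᵖ r) from h hx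
  refine sSup_le fun I hI => ?_
  rw [← Submodule.map_le_iff_le_comap]
  have hs : IsSimpleModule Rᵐᵒᵖ I := isSimpleModule_iff_isAtom.mpr hI
  let f : I →ₗ[Rᵐᵒᵖ] R := (LinearMap.mulLeft Rᵐᵒᵖ r).comp I.subtype
  have hmap : I.map (LinearMap.mulLeft Rᵐᵒᵖ r) = LinearMap.range f := by
    rw [LinearMap.range_comp, Submodule.range_subtype]
  rw [hmap]
  rcases f.injective_or_eq_zero with hf | hf
  · refine le_sSup (isSimpleModule_iff_isAtom.mp ?_)
    exact IsSimpleModule.congr (LinearEquiv.ofInjective f hf).symm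
  · rw [hf, LinearMap.range_zero]
    exact bot_le

/-- The right socle, as a two-sided ideal. -/
noncomputable def socleIdeal (R : Type*) [Ring R] : TwoSidedIdeal R :=
  TwoSidedIdeal.mk' (rightSocle R) (zero_mem _) (fun h h' => add_mem h h') (fun h => neg_mem h)
    (fun h => mul_mem_rightSocle _ h) (fun {_ y} h => (rightSocle R).smul_mem (op y) h)

theorem mem_socleIdeal {x : R} : x ∈ socleIdeal R ↔ x ∈ rightSocle R :=
  TwoSidedIdeal.mem_mk' ..

/-- The left annihilator of a two-sided ideal. -/
def TwoSidedIdeal.leftAnnihilator (M : TwoSidedIdeal R) : TwoSidedIdeal R :=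
  TwoSidedIdeal.mk' {r | ∀ m ∈ M, r * m = 0} (fun _ _ => zero_mul _)
    (fun h h' m hm => by rw [add_mul, h m hm, h' m hm, add_zero])
    (fun h m hm => by rw [neg_mul, h m hm, neg_zero])
    (fun h m hm => by rw [mul_assoc, h m hm, mul_zero])
    (fun h m hm => by rw [mul_assoc, h _ (M.mul_mem_left _ _ hm)])

theorem TwoSidedIdeal.mem_leftAnnihilator {M : TwoSidedIdeal R} {r : R} :
    r ∈ M.leftAnnihilator ↔ ∀ m ∈ M, r * m = 0 :=
  TwoSidedIdeal.mem_mk' ..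

theorem TwoSidedIdeal.ne_bot_of_mem {I : TwoSidedIdeal R} {x : R} (hx : x ∈ I) (h0 : x ≠ 0) :
    I ≠ ⊥ := by
  rintro rfl
  exact h0 ((TwoSidedIdeal.mem_bot R).mp hx)

/-- In a von Neumann regular ring, an ideal contained in its left annihilator is zero. -/
theorem TwoSidedIdeal.eq_bot_of_le_leftAnnihilator (hreg : ∀ a : R, ∃ x : R, a * x * a = a)
    {M : TwoSidedIdeal R} (h : M ≤ M.leftAnnihilator) : M = ⊥ := by
  rw [eq_bot_iff]
  intro m hm
  obtain ⟨x, hx⟩ := hreg m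
  rw [TwoSidedIdeal.mem_bot, ← hx]
  exact mem_leftAnnihilator.mp (h (M.mul_mem_right _ _ hm)) m hm

theorem rightSocle_eq_minimalIdeal (hreg : ∀ a : R, ∃ x : R, a * x * a = a)
    (hsi : IsSubdirectlyIrreducible R) (hsoc : rightSocle R ≠ ⊥) :
    (rightSocle R : Set R) = (minimalIdeal R : Set R) := by
  have hM := hsi.isLeast_minimalIdeal
  apply subset_antisymm
  · let N : Submodule Rᵐᵒᵖ R :=
      { carrier := minimalIdeal R
        add_mem' := fun h h' => (minimalIdeal R).add_mem h h'
        zero_mem' := (minimalIdeal R).zero_mem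
        smul_mem' := fun r _ h => (minimalIdeal R).mul_mem_right _ r.unop h }
    suffices h : rightSocle R ≤ N from h
    refine sSup_le fun I hI => ?_
    by_contra hIN
    -- By minimality I meets M(R) trivially, so I·M(R) ⊆ I ∩ M(R) = 0. The left annihilator of M(R)
    -- is thus a nonzero ideal and contains M(R).
    have hdis : I ⊓ N = ⊥ := (hI.le_iff.mp inf_le_left).resolve_right
      fun h => hIN (inf_eq_left.mp h)
    obtain ⟨x, hx, hx0⟩ := I.ne_bot_iff.mp hI.1
    have hann : x ∈ (minimalIdeal R).leftAnnihilator := by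
      refine TwoSidedIdeal.mem_leftAnnihilator.mpr fun m hm => ?_
      have : x * m ∈ I ⊓ N :=
        ⟨I.smul_mem (op m) hx, (minimalIdeal R).mul_mem_left _ _ hm⟩
      simpa [hdis] using this
    exact hM.1 (TwoSidedIdeal.eq_bot_of_le_leftAnnihilator hreg
      (hM.2 (TwoSidedIdeal.ne_bot_of_mem hann hx0)))
  · obtain ⟨x, hx, hx0⟩ := (rightSocle R).ne_bot_iff.mp hsoc
    intro m hm
    exact mem_socleIdeal.mp
      (hM.2 (TwoSidedIdeal.ne_bot_of_mem (mem_socleIdeal.mpr hx) hx0) hm)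

theorem exists_isArtinian_of_mem_rightSocle {x : R} (hx : x ∈ rightSocle R) :
    ∃ N : Submodule Rᵐᵒᵖ R, IsArtinian Rᵐᵒᵖ N ∧ x ∈ N := by
  rw [rightSocle, sSup_eq_iSup'] at hx
  refine Submodule.iSup_induction _ (motive := fun x => ∃ N : Submodule Rᵐᵒᵖ R,
    IsArtinian Rᵐᵒᵖ N ∧ x ∈ N) hx ?_ ⟨⊥, inferInstance, zero_mem _⟩ ?_
  · rintro ⟨I, hI⟩ y hy
    have : IsSimpleModule Rᵐᵒᵖ I := isSimpleModule_iff_isAtom.mpr hI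
    exact ⟨I, inferInstance, hy⟩
  · rintro y z ⟨N, hN, hy⟩ ⟨N', hN', hz⟩
    exact ⟨N ⊔ N', isArtinian_sup N N', Submodule.add_mem_sup hy hz⟩

end Socle

/-! ### Right ideals of a corner ring -/

namespace IsIdempotentElem.Corner

variable {R : Type*} [Ring R] {e : R} {he : IsIdempotentElem e}

theorem left_mul (s : he.Corner) : e * s.1 = s.1 :=
  ((Subsemigroup.mem_corner_iff he).mp s.2).1

theorem mul_right (s : he.Corner) : s.1 * e = s.1 :=
  ((Subsemigroup.mem_corner_iff he).mp s.2).2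

/-- The right ideal of `R` generated by a right ideal of the corner ring `eRe`. -/
def extendRight (J : Ideal he.Cornerᵐᵒᵖ) : Submodule Rᵐᵒᵖ R :=
  Submodule.span Rᵐᵒᵖ {x | ∃ s : he.Corner, op s ∈ J ∧ s.1 = x}

/-- On generators, s r e = s(ere) with s in J. The quantifier over r absorbs the scalars met in the
span induction. -/
theorem exists_mem_of_mem_extendRight {J : Ideal he.Cornerᵐᵒᵖ} {x : R} (hx : x ∈ extendRight J)
    (r : R) : ∃ s : he.Corner, op s ∈ J ∧ s.1 = x * r * e := by
  induction hx using Submodule.span_induction generalizing r with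
  | mem x hx =>
    obtain ⟨s, hs, rfl⟩ := hx
    refine ⟨s * ⟨e * r * e, r, rfl⟩, J.mul_mem_left (op ⟨e * r * e, r, rfl⟩) hs, ?_⟩
    change s.1 * (e * r * e) = _
    rw [← mul_assoc, ← mul_assoc, mul_right]
  | zero => exact ⟨0, J.zero_mem, by rw [zero_mul, zero_mul]; rfl⟩
  | add x y _ _ hx hy =>
    obtain ⟨s, hs, hsx⟩ := hx r
    obtain ⟨t, ht, hty⟩ := hy r
    exact ⟨s + t, J.add_mem hs ht, by rw [add_mul, add_mul, ← hsx, ← hty]; rfl⟩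
  | smul a x _ hx =>
    obtain ⟨s, hs, hsx⟩ := hx (a.unop * r)
    exact ⟨s, hs, by rw [hsx, ← mul_assoc]; rfl⟩

/-- JR ∩ eRe = J, so extending right ideals to R loses no information about their order. -/
theorem mem_extendRight {J : Ideal he.Cornerᵐᵒᵖ} {s : he.Corner} :
    s.1 ∈ extendRight J ↔ op s ∈ J := by
  refine ⟨fun h => ?_, fun h => Submodule.subset_span ⟨s, h, rfl⟩⟩
  obtain ⟨t, ht, hts⟩ := exists_mem_of_mem_extendRight h 1
  rw [mul_one, mul_right] at hts
  rwa [← Subtype.ext hts]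

/-- If `e` lies in an artinian right ideal of `R`, then the corner ring `eRe` is right artinian. -/
theorem isArtinianRing_op {N : Submodule Rᵐᵒᵖ R} [IsArtinian Rᵐᵒᵖ N] (heN : e ∈ N) :
    IsArtinianRing he.Cornerᵐᵒᵖ := by
  have hN : ∀ s : he.Corner, s.1 ∈ N := fun s => by
    rw [← left_mul s]
    exact N.smul_mem (op s.1) heN
  let f : Ideal he.Cornerᵐᵒᵖ → Submodule Rᵐᵒᵖ N := fun J => (extendRight J).comap N.subtype
  have hf : ∀ J K, f J ≤ f K ↔ J ≤ K := fun J K => by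
    constructor
    · intro h s hs
      exact mem_extendRight.mp (h (x := ⟨(unop s).1, hN _⟩) (mem_extendRight.mpr hs))
    · intro h
      refine Submodule.comap_mono (Submodule.span_mono ?_)
      rintro x ⟨s, hs, rfl⟩
      exact ⟨s, h hs, rfl⟩
  exact ⟨(OrderEmbedding.ofMapLEIff f hf).wellFounded wellFounded_lt⟩

end IsIdempotentElem.Corner

/-! ### Corners at projections -/

namespace IsStarProjection

variable {R : Type*} [Ring R] [StarRing R] {e : R}

/-- The corner ring of a projection is stable under the involution. -/
abbrev starRingCorner (he : IsStarProjection e) : StarRing he.isIdempotentElem.Corner where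
  star s := ⟨star s.1, by
    obtain ⟨r, hr⟩ := s.2
    refine ⟨star r, ?_⟩
    rw [← hr]
    simp [he.isSelfAdjoint.star_eq, mul_assoc]⟩
  star_involutive s := Subtype.ext (star_star s.1)
  star_mul s t := Subtype.ext (star_mul s.1 t.1)
  star_add s t := Subtype.ext (star_add s.1 t.1)

theorem isArtinianRing_corner (he : IsStarProjection e) (hs : e ∈ rightSocle R) :
    IsArtinianRing he.isIdempotentElem.Corner ∧
      IsArtinianRing (he.isIdempotentElem.Corner)ᵐᵒᵖ := by
  obtain ⟨N, hN, heN⟩ := exists_isArtinian_of_mem_rightSocle hs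
  have h := IsIdempotentElem.Corner.isArtinianRing_op (he := he.isIdempotentElem) heN
  let := he.starRingCorner
  -- The involution identifies eRe with its opposite, turning the right chain condition into the
  -- left one.
  exact ⟨(starRingEquiv (R := he.isIdempotentElem.Corner)).symm.isArtinianRing, h⟩

/-- The corner ring of a projection generating a minimal right ideal is a division ring. -/
noncomputable abbrev divisionRingCorner (he : IsStarProjection e) {I : Submodule Rᵐᵒᵖ R}
    (hI : IsAtom I) (heI : e ∈ I) (he0 : e ≠ 0) : DivisionRing he.isIdempotentElem.Corner :=
  haveI : Nontrivial he.isIdempotentElem.Corner :=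
    ⟨⟨1, 0, fun h => he0 (congrArg Subtype.val h)⟩⟩
  DivisionRing.ofIsUnitOrEqZero (by
    -- A nonzero s generates the minimal right ideal, so e = sr for some r, and ere is a right
    -- inverse of s inside the corner.
    have key : ∀ s : he.isIdempotentElem.Corner, s ≠ 0 → ∃ t, s * t = 1 := fun s hs => by
      have hsI : s.1 ∈ I := by
        rw [← IsIdempotentElem.Corner.left_mul s]
        exact I.smul_mem (op s.1) heI
      obtain ⟨r, hr⟩ := exists_mul_eq_of_isAtom hI hsI (fun h => hs (Subtype.ext h)) heI
      refine ⟨⟨e * r * e, r, rfl⟩, Subtype.ext ?_⟩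
      change s.1 * (e * r * e) = e
      rw [← mul_assoc, ← mul_assoc, IsIdempotentElem.Corner.mul_right, hr]
      exact he.isIdempotentElem
    intro s
    by_cases hs : s = 0
    · exact Or.inr hs
    obtain ⟨t, ht⟩ := key s hs
    have ht0 : t ≠ 0 := by
      rintro rfl
      exact one_ne_zero (ht.symm.trans (mul_zero s))
    -- The right inverse t has its own right inverse u, which must equal s, so t is a two-sided
    -- inverse.
    obtain ⟨u, hu⟩ := key t ht0
    have hsu : s = u := left_inv_eq_right_inv ht hu
    exact Or.inl ⟨⟨s, t, ht, hsu ▸ hu⟩, rfl⟩)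

end IsStarProjection

/-! ### The representation on Re -/

section Representation

variable {R : Type*} [Ring R]

/-- The left ideal `Re` generated by an idempotent `e`. -/
def leftPeirce (e : R) : AddSubgroup R where
  carrier := {x | x * e = x}
  add_mem' {x y} hx hy := by rw [Set.mem_ofPred_eq, add_mul, hx, hy]
  zero_mem' := zero_mul e
  neg_mem' {x} hx := by rw [Set.mem_ofPred_eq, neg_mul, hx]

/-- `Re` is a right module over the corner ring `eRe`. -/
instance {e : R} (he : IsIdempotentElem e) : Module he.Cornerᵐᵒᵖ (leftPeirce e) where
  smul s v := ⟨v.1 * (unop s).1, by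
    change _ * _ * e = _
    rw [mul_assoc, IsIdempotentElem.Corner.mul_right]⟩
  one_smul v := Subtype.ext v.2
  mul_smul s t v := Subtype.ext (mul_assoc v.1 (unop t).1 (unop s).1).symm
  smul_zero s := Subtype.ext (zero_mul (unop s).1)
  smul_add s v w := Subtype.ext (add_mul v.1 w.1 (unop s).1)
  add_smul s t v := Subtype.ext (mul_add v.1 (unop s).1 (unop t).1)
  zero_smul v := Subtype.ext (mul_zero v.1)

/-- The action of `R` on `Re` by left multiplication. -/
def leftPeirceAction {e : R} (he : IsIdempotentElem e) :
    R →+* Module.End he.Cornerᵐᵒᵖ (leftPeirce e) where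
  toFun r :=
    { toFun := fun v => ⟨r * v.1, by
        change r * v.1 * e = r * v.1
        rw [mul_assoc, v.2]⟩
      map_add' := fun v w => Subtype.ext (mul_add r v.1 w.1)
      map_smul' := fun s v => Subtype.ext (mul_assoc r v.1 (unop s).1).symm }
  map_one' := LinearMap.ext fun v => Subtype.ext (one_mul v.1)
  map_mul' r s := LinearMap.ext fun v => Subtype.ext (mul_assoc r s v.1)
  map_zero' := LinearMap.ext fun v => Subtype.ext (zero_mul v.1)
  map_add' r s := LinearMap.ext fun v => Subtype.ext (add_mul r s v.1)

end Representation

/-- A star-regular ring with a projection that lies in the minimal ideal and generates a minimal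
right ideal acts faithfully on `Re` with inner product `⟨v, w⟩ = v* w`. -/
theorem isRepresentable_of_isStarProjection {R : Type*} [Ring R] [StarRing R]
    (hreg : IsStarRegular R) (hsi : IsSubdirectlyIrreducible R) {e : R} (he : IsStarProjection e)
    {I : Submodule Rᵐᵒᵖ R} (hI : IsAtom I) (heI : e ∈ I) (he0 : e ≠ 0)
    (heM : e ∈ minimalIdeal R) : IsRepresentable R := by
  let := he.divisionRingCorner hI heI he0
  let := he.starRingCorner
  let B : InnerProduct he.isIdempotentElem.Corner (leftPeirce e) :=
    { form := fun v w => ⟨star v.1 * w.1, star v.1 * w.1, by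
        have hv : e * star v.1 = star v.1 := by
          have h := congrArg star (show v.1 * e = v.1 from v.2)
          rwa [star_mul, he.isSelfAdjoint.star_eq] at h
        change e * (star v.1 * w.1) * e = _
        rw [← mul_assoc, hv, mul_assoc, w.2]⟩
      add_left := fun u v w => Subtype.ext (by
        change star (u.1 + v.1) * w.1 = star u.1 * w.1 + star v.1 * w.1
        rw [star_add, add_mul])
      add_right := fun u v w => Subtype.ext (mul_add (star u.1) v.1 w.1)
      smul_smul := fun a b v w => Subtype.ext (by
        change star (v.1 * a.1) * (w.1 * b.1) = star a.1 * (star v.1 * w.1) * b.1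
        simp only [star_mul, mul_assoc])
      anisotropic := fun v hv => Subtype.ext (star_eq_zero.mp (hreg.proper _ (by
        rw [star_star]
        exact congrArg Subtype.val hv)))
      orthosymmetric := by
        have key : ∀ v w : R, star v * w = 0 → star w * v = 0 := fun v w h => by
          rw [← star_eq_zero, star_mul, star_star, h]
        exact fun v w => ⟨fun h => Subtype.ext (key v.1 w.1 (congrArg Subtype.val h)),
          fun h => Subtype.ext (key w.1 v.1 (congrArg Subtype.val h))⟩ }
  let L := leftPeirceAction he.isIdempotentElem
  have hadj : ∀ r : R, B.IsAdjoint (L r) (L (star r)) := fun r => by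
    constructor
    · intro v w
      refine Subtype.ext ?_
      change star (r * v.1) * w.1 = star v.1 * (star r * w.1)
      rw [star_mul, mul_assoc]
    · intro v w
      refine Subtype.ext ?_
      change star (star r * v.1) * w.1 = star v.1 * (r * w.1)
      rw [star_mul, star_star, mul_assoc]
  let ι : R →+* B.EndStar := L.codRestrict B.EndStar fun r => ⟨_, hadj r⟩
  refine ⟨_, _, _, _, _, _, B, ι, ?_,
    fun r => Subtype.ext ((hadj r).unique (B.isAdjoint_star (ι r)))⟩
  rw [← TwoSidedIdeal.ker_eq_bot]
  -- A nonzero kernel contains M(R), hence e; but e sends the vector e to e ≠ 0.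
  by_contra hker
  have hmem := hsi.isLeast_minimalIdeal.2 hker heM
  rw [TwoSidedIdeal.mem_ker] at hmem
  have h0 : L e = 0 := congrArg Subtype.val hmem
  have h1 := congrArg Subtype.val (LinearMap.congr_fun h0 ⟨e, he.isIdempotentElem⟩)
  exact he0 (he.isIdempotentElem.symm.trans h1)

theorem mainTheorem1 {R : Type*} [Ring R] [StarRing R] (hreg : IsStarRegular R)
    (hsi : IsSubdirectlyIrreducible R) (hsoc : rightSocle R ≠ ⊥) :
    (rightSocle R : Set R) = (minimalIdeal R : Set R) ∧
    (∀ (e : R) (he : IsStarProjection e), e ∈ minimalIdeal R →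
      IsArtinianRing he.isIdempotentElem.Corner ∧
      IsArtinianRing (he.isIdempotentElem.Corner)ᵐᵒᵖ) ∧
    IsRepresentable R := by
  have hSM := rightSocle_eq_minimalIdeal hreg.regular hsi hsoc
  have hmem : ∀ {x}, x ∈ rightSocle R ↔ x ∈ minimalIdeal R := fun {x} => Set.ext_iff.mp hSM x
  refine ⟨hSM, fun e he heM => he.isArtinianRing_corner (hmem.mpr heM), ?_⟩
  obtain ⟨I, hI⟩ : ∃ I : Submodule Rᵐᵒᵖ R, IsAtom I := by
    by_contra! h
    exact hsoc (sSup_eq_bot.mpr fun I hI => absurd hI (h I))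
  obtain ⟨a, ha, ha0⟩ := I.ne_bot_iff.mp hI.1
  obtain ⟨e, he, hea, y, hy⟩ := hreg.exists_isStarProjection a
  -- The projection stays in I because it is a right multiple of a, and is nonzero because it fixes
  -- a.
  have heI : e ∈ I := hy ▸ I.smul_mem (op y) ha
  have he0 : e ≠ 0 := by
    rintro rfl
    exact ha0 (hea.symm.trans (zero_mul a))
  exact isRepresentable_of_isStarProjection hreg hsi he hI heI he0
    (hmem.mp ((le_sSup hI : I ≤ rightSocle R) heI))
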